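/- Let $\mathbb T=\{t\in\mathbb C:|t|=1\}$ with normalized Lebesgue measure, let $H^2(\mathbb T)\subset L^2(\mathbb T)$ be the Hardy space, and let $P_+$ be the orthogonal projection of $L^2(\mathbb T)$ onto $H^2(\mathbb T)$. For $b\in L^\infty(\mathbb T)$ let $T_b$ be the Toeplitz operator on $H^2(\mathbb T)$ given by $T_bf=P_+(bf)$. Suppose that $$b(t)=\sum_{j=-1}^{\infty}b_jt^j,\qquad b_j\in\mathbb C,\qquad \sum_{j\ge 0}(j+1)|b_j|<\infty .$$ Then there is a constant $C(b)>0$, depending only on $b$, such that for every $w$ in the resolvent set $\rho(T_b)$ $$\bigl\|(T_b-w)^{-1}\bigr\|\le\frac{C(b)}{\operatorname{dist}(w,\sigma(T_b))}\left(1+\frac{1}{\operatorname{dist}(w,\sigma(T_b))}\right),$$ where $\sigma(T_b)=\mathbb C\setminus\rho(T_b)$ is the spectrum of $T_b$. -/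

import Mathlib

open MeasureTheory AddCircle
open scoped ENNReal

noncomputable section

/-- The unit circle, parametrized by the angle: `θ` stands for the point `t = e^{iθ}`, so that
`fourier j θ = t ^ j`. -/
abbrev UnitCirc : Type := AddCircle (2 * Real.pi)

instance factZeroLtTwoPi : Fact (0 < 2 * Real.pi) := ⟨Real.two_pi_pos⟩

/-- The normalized Lebesgue (arc length) measure on the unit circle. -/
abbrev circMeasure : Measure UnitCirc := haarAddCircle

/-- The space `L²` of the unit circle. -/
abbrev LTwo : Type := Lp ℂ 2 circMeasure

/-- The space `L^∞` of the unit circle. -/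
abbrev LInfty : Type := Lp ℂ ∞ circMeasure

/-- The Hardy space `H²`: the functions in `L²` of the circle all of whose Fourier coefficients
with negative index vanish. -/
def hardy : Submodule ℂ LTwo where
  carrier := {f | ∀ n : ℤ, n < 0 → fourierCoeff f n = 0}
  add_mem' := by
    intro f g hf hg n hn
    have hf' := hf n hn
    have hg' := hg n hn
    rw [← fourierBasis_repr] at hf' hg' ⊢
    simp [hf', hg']
  zero_mem' := by
    intro n _
    rw [← fourierBasis_repr]
    simp
  smul_mem' := by
    intro c f hf n hn
    have hf' := hf n hn
    rw [← fourierBasis_repr] at hf' ⊢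
    simp [hf']

theorem mem_hardy {f : LTwo} : f ∈ hardy ↔ ∀ n : ℤ, n < 0 → fourierCoeff f n = 0 := Iff.rfl

theorem isClosed_hardy : IsClosed (hardy : Set LTwo) := by
  have h : (hardy : Set LTwo) = ⋂ (n : ℤ) (_ : n < 0),
      {f : LTwo | inner ℂ (fourierBasis (T := 2 * Real.pi) n) f = 0} := by
    ext f
    simp only [SetLike.mem_coe, mem_hardy, Set.mem_iInter, Set.mem_ofPred_eq]
    simp only [← fourierBasis_repr, HilbertBasis.repr_apply_apply]
  rw [h]
  exact isClosed_iInter fun n => isClosed_iInter fun _ =>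
    isClosed_eq (continuous_const.inner continuous_id) continuous_const

instance completeSpace_hardy : CompleteSpace hardy := isClosed_hardy.completeSpace_coe

/-- The operator `f ↦ b f` of multiplication by `b ∈ L^∞` on `L²`. -/
def mulOp (b : LInfty) : LTwo →L[ℂ] LTwo :=
  (ContinuousLinearMap.mul ℂ ℂ).holderL circMeasure ∞ 2 2 b

/-- The Toeplitz operator `T_b f = P₊ (b f)` on the Hardy space, where `P₊` is the orthogonal
projection of `L²` onto `H²`. -/
def toeplitz (b : LInfty) : hardy →L[ℂ] hardy :=
  hardy.orthogonalProjectionOnto ∘L mulOp b ∘L hardy.subtypeL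

/-- Quadratic growth of the resolvent of a bounded operator `S`, with a constant that depends on
`S` only. On the resolvent set, `resolvent S w` is the bounded inverse of `w - S`, which has the
same norm as `(S - w)⁻¹`. -/
def QuadraticResolventGrowth {E : Type*} [NormedAddCommGroup E] [NormedSpace ℂ E]
    (S : E →L[ℂ] E) : Prop :=
  ∃ C : ℝ, 0 < C ∧ ∀ w ∈ resolventSet ℂ S,
    ‖resolvent S w‖ ≤ C / Metric.infDist w (spectrum ℂ S) *
      (1 + 1 / Metric.infDist w (spectrum ℂ S))

end

/-!
Write `a = b₋₁`, let `d n = b_{n-1}` and let `D(z) = ∑ d n * z ^ n = z * b(z)`, a power series that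
is Lipschitz on the closed disk because `∑ n * |d n| < ∞`. For `f ∈ H²` the product `b f` has only
one negative Fourier coefficient, `a * f(0)` at index `-1`. Hence `b f = T_b f + a * f(0) * t⁻¹` on
the circle (`mulOp_eq_toeplitz_add`) and `D(z) f(z) = a * f(0) + z * (T_b f)(z)` in the open disk
(`diskSum_mul_diskSum_fourierCoeff`).

Two facts about the spectrum are needed. The values of `b` on the circle belong to it
(`mem_spectrum_of_diskSum_eq`), by testing on the sums `∑_{n < N} (t / t₀) ^ n`. If
`D(z) - w * z` has no zero in the closed disk, then its reciprocal is an eigenvector of `T_b` for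
the eigenvalue `w` (`mem_spectrum_of_forall_ne`). No winding number enters: for `w` in the
resolvent set there is a zero `z₀` of `D(z) - w * z` in the open disk, and `|b - w| ≥ δ` on the
circle, where `δ` is the distance of `w` to the spectrum.

Let `(w - T_b) f = g`. Evaluating at `z₀` gives `a * f(0) = z₀ * g(z₀)`, so that
`|a * f(0)| ≤ ‖g‖ / (1 - |z₀|)`, and dividing `(w - b) f = g - a * f(0) * t⁻¹` by `w - b` on the
circle gives `‖f‖ ≤ δ⁻¹ * (1 + 1 / (1 - |z₀|)) * ‖g‖` (`norm_le_of_diskSum_eq`). Finally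
`w = b(z₀)`, and `b` is Lipschitz on `1 / 2 ≤ |z| ≤ 1`, so `δ ≤ L * (1 - |z₀|)` unless
`|z₀| < 1 / 2` (`exists_le_mul_one_sub_norm`).
-/

/-! ### Power series on the closed unit disk -/

/-- The power series `∑ d n * z ^ n` with coefficients `d`. -/
noncomputable def diskSum (d : ℕ → ℂ) (z : ℂ) : ℂ := ∑' n, d n * z ^ n

theorem norm_mul_pow_le {d : ℂ} {z : ℂ} (hz : ‖z‖ ≤ 1) (n : ℕ) : ‖d * z ^ n‖ ≤ ‖d‖ := by
  rw [norm_mul, norm_pow]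
  exact mul_le_of_le_one_right (norm_nonneg _) (pow_le_one₀ (norm_nonneg _) hz)

theorem summable_mul_pow {d : ℕ → ℂ} (hd : Summable fun n => ‖d n‖) {z : ℂ} (hz : ‖z‖ ≤ 1) :
    Summable fun n => d n * z ^ n :=
  Summable.of_norm_bounded hd fun n => norm_mul_pow_le hz n

theorem norm_diskSum_le {d : ℕ → ℂ} (hd : Summable fun n => ‖d n‖) {z : ℂ} (hz : ‖z‖ ≤ 1) :
    ‖diskSum d z‖ ≤ ∑' n, ‖d n‖ :=
  tsum_of_norm_bounded hd.hasSum fun n => norm_mul_pow_le hz n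

theorem continuousOn_diskSum {d : ℕ → ℂ} (hd : Summable fun n => ‖d n‖) :
    ContinuousOn (diskSum d) (Metric.closedBall 0 1) :=
  continuousOn_tsum (fun n => by fun_prop) hd fun n z hz =>
    norm_mul_pow_le (by simpa using hz) n

theorem differentiableOn_diskSum {d : ℕ → ℂ} (hd : Summable fun n => ‖d n‖) :
    DifferentiableOn ℂ (diskSum d) (Metric.ball 0 1) :=
  Complex.differentiableOn_tsum_of_summable_norm hd (fun n => by fun_prop) Metric.isOpen_ball
    fun n z hz => norm_mul_pow_le (by simpa using (Metric.mem_ball.1 hz).le) n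

theorem norm_pow_sub_pow_le_mul {z v : ℂ} (hz : ‖z‖ ≤ 1) (hv : ‖v‖ ≤ 1) (n : ℕ) :
    ‖z ^ n - v ^ n‖ ≤ n * ‖z - v‖ := by
  rw [← geom_sum₂_mul, norm_mul]
  refine mul_le_mul_of_nonneg_right ?_ (norm_nonneg _)
  refine (norm_sum_le_of_le _ (f := fun i => z ^ i * v ^ (n - 1 - i)) (n := fun _ => (1 : ℝ))
    fun i _ => ?_).trans (by simp)
  rw [norm_mul, norm_pow, norm_pow]
  exact mul_le_one₀ (pow_le_one₀ (norm_nonneg _) hz) (by positivity)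
    (pow_le_one₀ (norm_nonneg _) hv)

theorem norm_diskSum_sub_le {d : ℕ → ℂ} (hd : Summable fun n => ‖d n‖)
    (hd' : Summable fun n : ℕ => (n : ℝ) * ‖d n‖) {z v : ℂ} (hz : ‖z‖ ≤ 1) (hv : ‖v‖ ≤ 1) :
    ‖diskSum d z - diskSum d v‖ ≤ (∑' n : ℕ, (n : ℝ) * ‖d n‖) * ‖z - v‖ := by
  rw [diskSum, diskSum, ← (summable_mul_pow hd hz).tsum_sub (summable_mul_pow hd hv)]
  refine tsum_of_norm_bounded (hd'.hasSum.mul_right _) fun n => ?_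
  rw [← mul_sub, norm_mul]
  nlinarith [norm_pow_sub_pow_le_mul hz hv n, norm_nonneg (d n)]

/-! ### Fourier coefficients of square integrable functions -/

theorem inner_fourierLp (f : LTwo) (n : ℤ) :
    inner ℂ (fourierLp (T := 2 * Real.pi) 2 n) f = fourierCoeff f n := by
  rw [← fourierBasis_repr, HilbertBasis.repr_apply_apply, coe_fourierBasis]

theorem norm_fourierCoeff_le (f : LTwo) (n : ℤ) : ‖fourierCoeff f n‖ ≤ ‖f‖ := by
  rw [← inner_fourierLp]
  refine (norm_inner_le_norm _ _).trans ?_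
  rw [orthonormal_fourier.1 n, one_mul]

theorem fourierCoeff_sub_smul_fourierLp (f : LTwo) (l : ℂ) (m n : ℤ) :
    fourierCoeff (f - l • fourierLp (T := 2 * Real.pi) 2 m : LTwo) n
      = fourierCoeff f n - if n = m then l else 0 := by
  rw [← inner_fourierLp, inner_sub_right, inner_smul_right, inner_fourierLp,
    orthonormal_iff_ite.1 orthonormal_fourier]
  simp

theorem norm_fourier_apply (n : ℤ) (θ : UnitCirc) : ‖fourier n θ‖ = 1 := by
  rw [fourier_apply]; exact Circle.norm_coe _

theorem fourier_natCast (n : ℕ) (θ : UnitCirc) : fourier (n : ℤ) θ = fourier 1 θ ^ n := by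
  simp [fourier_apply, toCircle_nsmul]

theorem fourier_neg_one_mul (θ : UnitCirc) : fourier (-1) θ * fourier 1 θ = 1 := by
  rw [← fourier_add]; simp

/-- A bound for the value at `z` of the analytic extension of `g ∈ H²`. -/
theorem norm_diskSum_fourierCoeff_le (g : LTwo) {z : ℂ} (hz : ‖z‖ < 1) :
    ‖diskSum (fun n : ℕ => fourierCoeff g n) z‖ ≤ ‖g‖ / (1 - ‖z‖) := by
  refine tsum_of_norm_bounded
    ((hasSum_geometric_of_lt_one (norm_nonneg z) hz).mul_left ‖g‖) fun n => ?_
  rw [norm_mul, norm_pow]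
  exact mul_le_mul_of_nonneg_right (norm_fourierCoeff_le g n) (by positivity)

/-! ### Symbols with a single negative frequency

The hypothesis `b θ = fourier (-1) θ * diskSum d (fourier 1 θ)` below says that
`b(t) = ∑ d n * t ^ (n - 1)`. -/

theorem mulOp_coe_ae (b : LInfty) (f : LTwo) :
    (mulOp b f : UnitCirc → ℂ) =ᵐ[circMeasure] fun θ => b θ * f θ :=
  ContinuousLinearMap.coeFn_holder (ContinuousLinearMap.mul ℂ ℂ) b f

theorem hasSum_fourierCoeff_mulOp {b : LInfty} {d : ℕ → ℂ} (hd : Summable fun n => ‖d n‖)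
    (hb : ∀ᵐ θ ∂circMeasure, b θ = fourier (-1) θ * diskSum d (fourier 1 θ))
    (f : LTwo) (n : ℤ) :
    HasSum (fun k : ℕ => d k * fourierCoeff f (n + 1 - k)) (fourierCoeff (mulOp b f) n) := by
  have hf : Integrable (f : UnitCirc → ℂ) circMeasure :=
    (Lp.memLp f).integrable (by norm_num)
  have hint : ∀ m : ℤ, Integrable (fun θ => fourier m θ * f θ) circMeasure := fun m => by
    have h := hf.fourier_smul m
    simpa only [smul_eq_mul] using h
  have key := hasSum_integral_of_summable_integral_norm (μ := circMeasure)
    (F := fun (k : ℕ) θ => d k * (fourier (-(n + 1 - k)) θ * f θ))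
    (fun k => (hint _).const_mul _) (by
      simp only [norm_mul, norm_fourier_apply, one_mul, integral_const_mul]
      exact hd.mul_right _)
  simp only [integral_const_mul] at key
  have hval : fourierCoeff (mulOp b f) n = ∫ θ, ∑' k : ℕ,
      d k * (fourier (-(n + 1 - k)) θ * f θ) ∂circMeasure := by
    refine integral_congr_ae ?_
    filter_upwards [mulOp_coe_ae b f, hb] with θ h1 h2
    rw [smul_eq_mul, h1, h2, diskSum, ← tsum_mul_left, ← tsum_mul_right, ← tsum_mul_left]
    refine tsum_congr fun k => ?_
    rw [show -(n + 1 - (k : ℤ)) = -n + (-1 + k) by ring, fourier_add, fourier_add,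
      fourier_natCast]
    ring
  rw [hval]
  exact key

theorem orthogonalProjectionOnto_fourierLp_neg_one :
    hardy.orthogonalProjectionOnto (fourierLp (T := 2 * Real.pi) 2 (-1)) = 0 := by
  rw [Submodule.orthogonalProjectionOnto_eq_zero_iff]
  rw [Submodule.mem_orthogonal']
  intro f hf
  rw [inner_fourierLp]
  exact hf (-1) (by norm_num)

theorem toeplitz_apply (b : LInfty) (f : hardy) :
    toeplitz b f = hardy.orthogonalProjectionOnto (mulOp b f) := rfl

theorem mulOp_eq_toeplitz_add {b : LInfty} {d : ℕ → ℂ} (hd : Summable fun n => ‖d n‖)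
    (hb : ∀ᵐ θ ∂circMeasure, b θ = fourier (-1) θ * diskSum d (fourier 1 θ)) (f : hardy) :
    mulOp b f = (toeplitz b f : LTwo) +
      (d 0 * fourierCoeff (f : LTwo) 0) • fourierLp (T := 2 * Real.pi) 2 (-1) := by
  set l := d 0 * fourierCoeff (f : LTwo) 0 with hl
  have hmem : mulOp b f - l • fourierLp (T := 2 * Real.pi) 2 (-1) ∈ hardy := by
    intro n hn
    rw [fourierCoeff_sub_smul_fourierLp, sub_eq_zero]
    refine (hasSum_fourierCoeff_mulOp hd hb f n).unique ?_
    split_ifs with h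
    · subst h
      convert hasSum_single (f := fun k : ℕ => d k * fourierCoeff (f : LTwo) (-1 + 1 - k)) 0 ?_
        using 1
      · simp [hl]
      · intro k hk
        rw [f.2 _ (by omega), mul_zero]
    · convert hasSum_zero (α := ℂ) (β := ℕ) using 2 with k
      rw [f.2 _ (by omega), mul_zero]
  have h := congrArg (Subtype.val)
    (Submodule.orthogonalProjectionOnto_mem_subspace_eq_self (K := hardy) ⟨_, hmem⟩)
  simp only [map_sub, map_smul, orthogonalProjectionOnto_fourierLp_neg_one, smul_zero,
    sub_zero] at h
  rw [toeplitz_apply, h, sub_add_cancel]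

/-- The analytic form of `T_b`: multiplying `f ∈ H²` by `z * b(z)` gives
`z * (T_b f)(z) + b₋₁ * f(0)` in the open disk. -/
theorem diskSum_mul_diskSum_fourierCoeff {b : LInfty} {d : ℕ → ℂ} (hd : Summable fun n => ‖d n‖)
    (hb : ∀ᵐ θ ∂circMeasure, b θ = fourier (-1) θ * diskSum d (fourier 1 θ)) (f : hardy)
    {z : ℂ} (hz : ‖z‖ < 1) :
    diskSum d z * diskSum (fun n : ℕ => fourierCoeff (f : LTwo) n) z =
      d 0 * fourierCoeff (f : LTwo) 0 +
        z * diskSum (fun n : ℕ => fourierCoeff (toeplitz b f : LTwo) n) z := by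
  have hsum : ∀ g : LTwo, Summable fun n : ℕ => ‖fourierCoeff g n * z ^ n‖ := fun g => by
    refine Summable.of_nonneg_of_le (fun _ => norm_nonneg _) (fun n => ?_)
      ((summable_geometric_of_lt_one (norm_nonneg z) hz).mul_left ‖g‖)
    rw [norm_mul, norm_pow]
    exact mul_le_mul_of_nonneg_right (norm_fourierCoeff_le g n) (by positivity)
  have hsumd : Summable fun n => ‖d n * z ^ n‖ :=
    Summable.of_nonneg_of_le (fun _ => norm_nonneg _) (fun n => norm_mul_pow_le hz.le n) hd
  have hcoef : ∀ n : ℕ, ∑ kl ∈ Finset.HasAntidiagonal.antidiagonal n,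
      d kl.1 * z ^ kl.1 * (fourierCoeff (f : LTwo) kl.2 * z ^ kl.2) =
        fourierCoeff (mulOp b f) ((n : ℤ) - 1) * z ^ n := by
    intro n
    have h : fourierCoeff (mulOp b f) ((n : ℤ) - 1) =
        ∑ k ∈ Finset.range (n + 1), d k * fourierCoeff (f : LTwo) ((n : ℤ) - 1 + 1 - k) := by
      refine (hasSum_fourierCoeff_mulOp hd hb f _).unique (hasSum_sum_of_ne_finset_zero ?_)
      intro k hk
      rw [Finset.mem_range] at hk
      rw [f.2 _ (by omega), mul_zero]
    rw [h, Finset.Nat.sum_antidiagonal_eq_sum_range_succ_mk, Finset.sum_mul]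
    refine Finset.sum_congr rfl fun k hk => ?_
    have hk' : k ≤ n := by rw [Finset.mem_range] at hk; omega
    rw [show ((n : ℤ) - 1 + 1 - k) = ((n - k : ℕ) : ℤ) by omega]
    have : z ^ n = z ^ k * z ^ (n - k) := by rw [← pow_add]; congr 1; omega
    rw [this]; ring
  have hS := summable_norm_sum_mul_antidiagonal_of_summable_norm hsumd (hsum f)
  have hP := tsum_mul_tsum_eq_tsum_sum_antidiagonal_of_summable_norm hsumd (hsum f)
  simp only [hcoef] at hS hP
  have hM := mulOp_eq_toeplitz_add hd hb f
  have hneg : fourierCoeff (mulOp b f) (-1) = d 0 * fourierCoeff (f : LTwo) 0 := by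
    have h := fourierCoeff_sub_smul_fourierLp (mulOp b f)
      (d 0 * fourierCoeff (f : LTwo) 0) (-1) (-1)
    rw [if_pos rfl, hM, add_sub_cancel_right, (toeplitz b f).2 _ (by norm_num), ← hM] at h
    exact (sub_eq_zero.1 h.symm)
  have hnat : ∀ n : ℕ, fourierCoeff (mulOp b f) n = fourierCoeff (toeplitz b f : LTwo) n := by
    intro n
    have h := fourierCoeff_sub_smul_fourierLp (mulOp b f)
      (d 0 * fourierCoeff (f : LTwo) 0) (-1) n
    rw [if_neg (by omega), hM, add_sub_cancel_right, ← hM, sub_zero] at h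
    exact h.symm
  rw [diskSum, diskSum, diskSum, hP, hS.of_norm.tsum_eq_zero_add, ← tsum_mul_left]
  congr 1
  · simp [hneg]
  · refine tsum_congr fun n => ?_
    rw [show (((n + 1 : ℕ) : ℤ) - 1) = n by push_cast; ring, hnat, pow_succ]
    ring

/-! ### Points of the spectrum -/

theorem exists_norm_le_of_mem_resolventSet {E : Type*} [NormedAddCommGroup E] [NormedSpace ℂ E]
    {S : E →L[ℂ] E} {w : ℂ} (hw : w ∈ resolventSet ℂ S) (f : E) :
    ‖f‖ ≤ ‖resolvent S w‖ * ‖w • f - S f‖ := by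
  have h : resolvent S w * (algebraMap ℂ (E →L[ℂ] E) w - S) = 1 := Ring.inverse_mul_cancel _ hw
  have h2 := congrArg (fun A : E →L[ℂ] E => A f) h
  simp only [mul_apply_eq_comp, sub_apply,
    Algebra.algebraMap_eq_smul_one, smul_apply,
    one_apply_eq_self] at h2
  calc ‖f‖ = ‖resolvent S w (w • f - S f)‖ := by rw [h2]
    _ ≤ _ := ContinuousLinearMap.le_opNorm _ _

theorem norm_smul_sub_toeplitz_le (b : LInfty) (w : ℂ) (f : hardy) :
    ‖w • f - toeplitz b f‖ ≤ ‖w • (f : LTwo) - mulOp b f‖ := by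
  have h : w • f - toeplitz b f =
      hardy.orthogonalProjectionOnto (w • (f : LTwo) - mulOp b f) := by
    rw [map_sub, map_smul, Submodule.orthogonalProjectionOnto_mem_subspace_eq_self, toeplitz_apply]
  rw [h]
  exact Submodule.norm_orthogonalProjectionOnto_apply_le _ _

theorem smul_sub_mulOp_ae {b : LInfty} {d : ℕ → ℂ}
    (hb : ∀ᵐ θ ∂circMeasure, b θ = fourier (-1) θ * diskSum d (fourier 1 θ))
    (w : ℂ) (f : LTwo) :
    (w • f - mulOp b f : LTwo) =ᵐ[circMeasure] fun θ =>
      -(fourier (-1) θ * ((diskSum d (fourier 1 θ) - w * fourier 1 θ) * f θ)) := by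
  filter_upwards [hb, mulOp_coe_ae b f, Lp.coeFn_sub (w • f) (mulOp b f), Lp.coeFn_smul w f]
    with θ h1 h2 h3 h4
  rw [h3, Pi.sub_apply, h4, Pi.smul_apply, h2, h1, smul_eq_mul]
  linear_combination (-w * f θ) * fourier_neg_one_mul θ

/-- The Dirichlet-type sums `∑_{n < N} s ^ n * t ^ n`, which concentrate near `t = s⁻¹`. -/
noncomputable def dirichletSum (s : ℂ) (N : ℕ) : LTwo :=
  ∑ n ∈ Finset.range N, s ^ n • fourierLp (T := 2 * Real.pi) 2 (n : ℤ)

theorem dirichletSum_mem_hardy (s : ℂ) (N : ℕ) : dirichletSum s N ∈ hardy := by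
  refine Submodule.sum_mem _ fun n _ => Submodule.smul_mem _ _ fun m hm => ?_
  rw [← inner_fourierLp, orthonormal_iff_ite.1 orthonormal_fourier, if_neg (by omega)]

theorem norm_sq_dirichletSum {s : ℂ} (hs : ‖s‖ = 1) (N : ℕ) : ‖dirichletSum s N‖ ^ 2 = N := by
  have ho : Orthonormal ℂ fun n : ℕ => fourierLp (T := 2 * Real.pi) 2 (n : ℤ) :=
    orthonormal_fourier.comp _ Nat.cast_injective
  have h : inner ℂ (dirichletSum s N) (dirichletSum s N) = (N : ℂ) := by
    rw [dirichletSum, ho.inner_sum (fun n => s ^ n) (fun n => s ^ n)]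
    simp [← mul_pow, RCLike.conj_mul, hs]
  have h1 := congrArg Complex.re h
  rwa [← RCLike.re_eq_complex_re, inner_self_eq_norm_sq, RCLike.re_eq_complex_re,
    Complex.natCast_re] at h1

theorem dirichletSum_coe_ae (s : ℂ) (N : ℕ) :
    (dirichletSum s N : UnitCirc → ℂ) =ᵐ[circMeasure]
      fun θ => ∑ n ∈ Finset.range N, (s * fourier 1 θ) ^ n := by
  induction N with
  | zero =>
    filter_upwards [Lp.coeFn_zero (E := ℂ) (p := 2) (μ := circMeasure)] with θ h
    simp [dirichletSum]
  | succ N ih =>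
    have h0 : dirichletSum s (N + 1) =
        dirichletSum s N + s ^ N • fourierLp (T := 2 * Real.pi) 2 (N : ℤ) :=
      Finset.sum_range_succ _ _
    rw [h0]
    filter_upwards [ih, Lp.coeFn_add (dirichletSum s N)
      (s ^ N • fourierLp (T := 2 * Real.pi) 2 (N : ℤ)),
      Lp.coeFn_smul (s ^ N) (fourierLp (T := 2 * Real.pi) 2 (N : ℤ)),
      coeFn_fourierLp (T := 2 * Real.pi) 2 (N : ℤ)] with θ h1 h2 h3 h4
    rw [h2, Pi.add_apply, h1, h3, Pi.smul_apply, h4, Finset.sum_range_succ, smul_eq_mul,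
      fourier_natCast, mul_pow]

theorem Lp_norm_le_of_ae_bound {f : LTwo} {C : ℝ} (hC : 0 ≤ C)
    (h : ∀ᵐ θ ∂circMeasure, ‖f θ‖ ≤ C) : ‖f‖ ≤ C := by
  simpa [measureUnivNNReal] using Lp.norm_le_of_ae_bound hC h

/-- The range of the symbol on the circle lies in the spectrum: if `b(t₀) = w`, the sums
`∑_{n < N} (t / t₀) ^ n` have norms `√N`, but their images under `T_b - w` stay bounded because
`b - w` vanishes at `t₀` to first order. -/
theorem mem_spectrum_of_diskSum_eq {b : LInfty} {d : ℕ → ℂ} (hd : Summable fun n => ‖d n‖)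
    (hd' : Summable fun n : ℕ => (n : ℝ) * ‖d n‖)
    (hb : ∀ᵐ θ ∂circMeasure, b θ = fourier (-1) θ * diskSum d (fourier 1 θ))
    {w t : ℂ} (ht : ‖t‖ = 1) (h : diskSum d t = w * t) : w ∈ spectrum ℂ (toeplitz b) := by
  by_contra hw
  have hw' : w ∈ resolventSet ℂ (toeplitz b) := not_not.1 hw
  have ht0 : t ≠ 0 := by rintro rfl; simp at ht
  set L := (∑' n : ℕ, (n : ℝ) * ‖d n‖) + ‖w‖ with hL
  have hL0 : 0 ≤ L := add_nonneg (tsum_nonneg fun n => by positivity) (norm_nonneg _)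
  have hlip : ∀ z : ℂ, ‖z‖ = 1 → ‖diskSum d z - w * z‖ ≤ L * ‖z - t‖ := by
    intro z hz
    have h1 := norm_diskSum_sub_le hd hd' hz.le ht.le
    have h2 : diskSum d z - w * z = (diskSum d z - diskSum d t) - w * (z - t) := by
      rw [h]; ring
    rw [h2]
    refine (norm_sub_le _ _).trans ?_
    rw [norm_mul, hL, add_mul]
    linarith
  have hbound : ∀ N, ‖dirichletSum t⁻¹ N‖ ≤ ‖resolvent (toeplitz b) w‖ * (L * 2) := by
    intro N
    refine (exists_norm_le_of_mem_resolventSet hw'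
      ⟨dirichletSum t⁻¹ N, dirichletSum_mem_hardy _ N⟩).trans ?_
    refine mul_le_mul_of_nonneg_left ?_ (ContinuousLinearMap.opNorm_nonneg _)
    refine (norm_smul_sub_toeplitz_le _ _ _).trans ?_
    refine Lp_norm_le_of_ae_bound (by positivity) ?_
    filter_upwards [smul_sub_mulOp_ae hb w (dirichletSum t⁻¹ N), dirichletSum_coe_ae t⁻¹ N]
      with θ h1 h2
    have hθ := norm_fourier_apply 1 θ
    rw [h1, norm_neg, norm_mul, norm_mul, norm_fourier_apply, one_mul, h2]
    set z : ℂ := fourier 1 θ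
    have hu : ‖t⁻¹ * z‖ = 1 := by rw [norm_mul, norm_inv, ht, hθ]; norm_num
    have hg : ‖∑ n ∈ Finset.range N, (t⁻¹ * z) ^ n‖ * ‖z - t‖ ≤ 2 := by
      have h3 : ‖z - t‖ = ‖t⁻¹ * z - 1‖ := by
        rw [show z - t = t * (t⁻¹ * z - 1) by field_simp, norm_mul, ht, one_mul]
      rw [h3, ← norm_mul, geom_sum_mul]
      refine (norm_sub_le _ _).trans ?_
      rw [norm_pow, hu]; norm_num
    calc _ ≤ L * ‖z - t‖ * ‖∑ n ∈ Finset.range N, (t⁻¹ * z) ^ n‖ :=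
          mul_le_mul_of_nonneg_right (hlip z hθ) (norm_nonneg _)
      _ = L * (‖∑ n ∈ Finset.range N, (t⁻¹ * z) ^ n‖ * ‖z - t‖) := by ring
      _ ≤ L * 2 := mul_le_mul_of_nonneg_left hg hL0
  obtain ⟨N, hN⟩ := exists_nat_gt ((‖resolvent (toeplitz b) w‖ * (L * 2)) ^ 2)
  have h1 := pow_le_pow_left₀ (norm_nonneg _) (hbound N) 2
  rw [norm_sq_dirichletSum (by rw [norm_inv, ht, inv_one])] at h1
  linarith

/-- Negative Fourier coefficients of the boundary values of a function that is holomorphic in the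
disk and continuous up to the boundary vanish, by Cauchy's theorem. -/
theorem fourierCoeff_eq_zero_of_differentiableOn {F : ℂ → ℂ}
    (hc : ContinuousOn F (Metric.closedBall 0 1)) (hF : DifferentiableOn ℂ F (Metric.ball 0 1))
    {n : ℤ} (hn : n < 0) :
    fourierCoeff (fun θ : UnitCirc => F (fourier 1 θ)) n = 0 := by
  obtain ⟨m, rfl⟩ : ∃ m : ℕ, n = -(m + 1 : ℤ) := ⟨(-n - 1).toNat, by omega⟩
  have hcauchy : ∮ z in C(0, 1), z ^ m * F z = 0 :=
    Complex.circleIntegral_eq_zero_of_differentiable_on_off_countable zero_le_one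
      Set.countable_empty ((by fun_prop : ContinuousOn (fun z : ℂ => z ^ m) _).mul hc)
      fun z hz => (by fun_prop : DifferentiableAt ℂ (fun z : ℂ => z ^ m) z).mul
        (hF.differentiableAt (Metric.isOpen_ball.mem_nhds hz.1))
  rw [circleIntegral] at hcauchy
  rw [fourierCoeff_eq_intervalIntegral _ _ 0, zero_add, neg_neg]
  have h1 : ∀ x : ℝ, (fourier 1 (x : UnitCirc) : ℂ) = circleMap 0 1 x := by
    intro x
    rw [fourier_coe_apply, circleMap]
    have : (Real.pi : ℂ) ≠ 0 := by exact_mod_cast Real.pi_ne_zero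
    push_cast
    simp only [zero_add, one_mul]
    congr 1
    field_simp
  have h2 : ∀ x : ℝ, (fourier ((m : ℤ) + 1) (x : UnitCirc) : ℂ) • F (fourier 1 (x : UnitCirc)) =
      -Complex.I * (deriv (circleMap 0 1) x • (circleMap 0 1 x ^ m * F (circleMap 0 1 x))) := by
    intro x
    rw [fourier_add, fourier_natCast, h1, deriv_circleMap]
    simp only [smul_eq_mul]
    linear_combination (circleMap 0 1 x ^ (m + 1) * F (circleMap 0 1 x)) * Complex.I_sq
  simp only [h2]
  rw [intervalIntegral.integral_const_mul, hcauchy]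
  simp

/-- If `z * (b(z) - w)` has no zero in the closed disk, its reciprocal is an eigenvector of `T_b`
for the eigenvalue `w`. -/
theorem mem_spectrum_of_forall_ne {b : LInfty} {d : ℕ → ℂ} (hd : Summable fun n => ‖d n‖)
    (hb : ∀ᵐ θ ∂circMeasure, b θ = fourier (-1) θ * diskSum d (fourier 1 θ))
    {w : ℂ} (h : ∀ z : ℂ, ‖z‖ ≤ 1 → diskSum d z ≠ w * z) : w ∈ spectrum ℂ (toeplitz b) := by
  by_contra hw
  have hw' : w ∈ resolventSet ℂ (toeplitz b) := not_not.1 hw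
  set F : ℂ → ℂ := fun z => (diskSum d z - w * z)⁻¹ with hFdef
  have hne : ∀ z : ℂ, ‖z‖ ≤ 1 → diskSum d z - w * z ≠ 0 := fun z hz => sub_ne_zero.2 (h z hz)
  have hFc : ContinuousOn F (Metric.closedBall 0 1) :=
    ((continuousOn_diskSum hd).sub (by fun_prop)).inv₀ fun z hz => hne z (by simpa using hz)
  have hFd : DifferentiableOn ℂ F (Metric.ball 0 1) :=
    ((differentiableOn_diskSum hd).sub (by fun_prop)).inv
      fun z hz => hne z (by simpa using (Metric.mem_ball.1 hz).le)
  let φ : C(UnitCirc, ℂ) := ⟨fun θ => F (fourier 1 θ), hFc.comp_continuous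
    (fourier 1).continuous fun θ =>
      mem_closedBall_zero_iff.2 (norm_fourier_apply 1 θ).le⟩
  let f : LTwo := ContinuousMap.toLp 2 circMeasure ℂ φ
  have hf : f ∈ hardy := fun n hn => by
    rw [fourierCoeff_toLp]
    exact fourierCoeff_eq_zero_of_differentiableOn hFc hFd hn
  have hfv : w • f - mulOp b f = -fourierLp (T := 2 * Real.pi) 2 (-1) := by
    refine Lp.ext ?_
    filter_upwards [smul_sub_mulOp_ae hb w f,
      ContinuousMap.coeFn_toLp (p := 2) circMeasure (𝕜 := ℂ) φ,
      Lp.coeFn_neg (fourierLp (T := 2 * Real.pi) 2 (-1)),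
      coeFn_fourierLp (T := 2 * Real.pi) 2 (-1)] with θ h1 h2 h3 h4
    rw [h1, h2, h3, Pi.neg_apply, h4]
    change -(_ * (_ * (_)⁻¹)) = _
    rw [mul_inv_cancel₀ (hne _ (norm_fourier_apply 1 θ).le), mul_one]
  have hker : w • (⟨f, hf⟩ : hardy) - toeplitz b ⟨f, hf⟩ = 0 := by
    have h1 := congrArg hardy.orthogonalProjectionOnto hfv
    rw [map_neg, orthogonalProjectionOnto_fourierLp_neg_one, neg_zero, map_sub, map_smul] at h1
    have h2 := Submodule.orthogonalProjectionOnto_mem_subspace_eq_self (K := hardy) ⟨f, hf⟩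
    rw [toeplitz_apply, ← h1, h2]
  have hf0 : f = 0 := by
    have h1 := exists_norm_le_of_mem_resolventSet hw' (⟨f, hf⟩ : hardy)
    rw [hker, norm_zero, mul_zero] at h1
    exact congrArg Subtype.val (norm_le_zero_iff.1 h1)
  rw [hf0, smul_zero, map_zero, sub_zero, eq_comm, neg_eq_zero] at hfv
  have h1 := orthonormal_fourier (T := 2 * Real.pi).1 (-1)
  rw [hfv, norm_zero] at h1
  exact zero_ne_one h1

/-! ### The resolvent estimate -/

/-- A zero of `z * (b(z) - w)` at distance `1 - ‖z₀‖` from the circle bounds `b - w` on the circle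
by a multiple of that distance, uniformly in `w`. -/
theorem exists_le_mul_one_sub_norm {d : ℕ → ℂ} (hd : Summable fun n => ‖d n‖)
    (hd' : Summable fun n : ℕ => (n : ℝ) * ‖d n‖) :
    ∃ L : ℝ, 0 ≤ L ∧ ∀ (w z : ℂ) (δ : ℝ), ‖z‖ < 1 → 1 / 2 ≤ ‖z‖ → diskSum d z = w * z →
      (∀ t : ℂ, ‖t‖ = 1 → δ ≤ ‖diskSum d t - w * t‖) → δ ≤ L * (1 - ‖z‖) := by
  refine ⟨(∑' n : ℕ, (n : ℝ) * ‖d n‖) + 2 * ∑' n, ‖d n‖,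
    add_nonneg (tsum_nonneg fun n => by positivity)
      (mul_nonneg zero_le_two (tsum_nonneg fun n => norm_nonneg _)), ?_⟩
  intro w z δ hz hz2 hwz hδ
  have hzpos : 0 < ‖z‖ := by linarith
  have hz0 : (‖z‖ : ℂ) ≠ 0 := by exact_mod_cast hzpos.ne'
  have ht : ‖z / (‖z‖ : ℂ)‖ = 1 := by simp [hzpos.ne']
  have htz : ‖z / (‖z‖ : ℂ) - z‖ = 1 - ‖z‖ := by
    have : z / (‖z‖ : ℂ) - z = z / (‖z‖ : ℂ) * ((1 - ‖z‖ : ℝ) : ℂ) := by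
      push_cast; field_simp
    rw [this, norm_mul, ht, one_mul, Complex.norm_real, Real.norm_of_nonneg (by linarith)]
  have hw : ‖w‖ ≤ 2 * ∑' n, ‖d n‖ := by
    have h1 := norm_diskSum_le hd hz.le
    rw [hwz, norm_mul] at h1
    nlinarith [norm_nonneg w]
  have h1 := norm_diskSum_sub_le hd hd' ht.le hz.le
  have h2 := hδ _ ht
  set t := z / (‖z‖ : ℂ)
  have h3 : diskSum d t - w * t = (diskSum d t - diskSum d z) - w * (t - z) := by
    rw [hwz]; ring
  rw [h3] at h2
  have h4 := norm_sub_le (diskSum d t - diskSum d z) (w * (t - z))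
  rw [norm_mul, htz] at h4
  rw [htz] at h1
  nlinarith [mul_le_mul_of_nonneg_right hw (by linarith : 0 ≤ 1 - ‖z‖)]

/-- Solving `(w - T_b) f = g` with the help of a zero `z` of `z * (b(z) - w)` in the disk: the
value of the equation at `z` determines `b₋₁ * f(0)`, and then `f` is bounded by dividing by
`b - w` on the circle. -/
theorem norm_le_of_diskSum_eq {b : LInfty} {d : ℕ → ℂ} (hd : Summable fun n => ‖d n‖)
    (hb : ∀ᵐ θ ∂circMeasure, b θ = fourier (-1) θ * diskSum d (fourier 1 θ))
    {w z : ℂ} (hz : ‖z‖ < 1) (hwz : diskSum d z = w * z) {δ : ℝ} (hδ0 : 0 < δ)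
    (hδ : ∀ t : ℂ, ‖t‖ = 1 → δ ≤ ‖diskSum d t - w * t‖) (f : hardy) :
    ‖f‖ ≤ δ⁻¹ * (1 + 1 / (1 - ‖z‖)) * ‖w • f - toeplitz b f‖ := by
  set g : hardy := w • f - toeplitz b f with hg
  set l := d 0 * fourierCoeff (f : LTwo) 0 with hl
  have hz1 : 0 < 1 - ‖z‖ := by linarith
  have hlval : l = z * diskSum (fun n : ℕ => fourierCoeff (g : LTwo) n) z := by
    have h1 := diskSum_mul_diskSum_fourierCoeff hd hb f hz
    have hS : ∀ u : LTwo, Summable fun n : ℕ => fourierCoeff u n * z ^ n := fun u => by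
      refine Summable.of_norm_bounded
        ((summable_geometric_of_lt_one (norm_nonneg z) hz).mul_left ‖u‖) fun n => ?_
      rw [norm_mul, norm_pow]
      exact mul_le_mul_of_nonneg_right (norm_fourierCoeff_le u n) (by positivity)
    have h2 : diskSum (fun n : ℕ => fourierCoeff (g : LTwo) n) z =
        w * diskSum (fun n : ℕ => fourierCoeff (f : LTwo) n) z -
          diskSum (fun n : ℕ => fourierCoeff (toeplitz b f : LTwo) n) z := by
      rw [diskSum, diskSum, diskSum, ← tsum_mul_left, ← ((hS f).mul_left w).tsum_sub (hS _)]
      refine tsum_congr fun n => ?_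
      have : fourierCoeff (g : LTwo) n =
          w * fourierCoeff (f : LTwo) n - fourierCoeff (toeplitz b f : LTwo) n := by
        simp only [← inner_fourierLp, hg, Submodule.coe_sub, Submodule.coe_smul, inner_sub_right,
          inner_smul_right]
      rw [this]; ring
    rw [h2, mul_sub]
    rw [hwz] at h1
    linear_combination -h1
  have hlnorm : ‖l‖ ≤ 1 / (1 - ‖z‖) * ‖g‖ := by
    rw [hlval, norm_mul]
    calc _ ≤ 1 * (‖(g : LTwo)‖ / (1 - ‖z‖)) :=
          mul_le_mul hz.le (norm_diskSum_fourierCoeff_le _ hz) (norm_nonneg _) zero_le_one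
      _ = 1 / (1 - ‖z‖) * ‖g‖ := by rw [Submodule.coe_norm]; ring
  have hv : ‖w • (f : LTwo) - mulOp b f‖ ≤ ‖g‖ + ‖l‖ := by
    have h1 : w • (f : LTwo) - mulOp b f =
        (g : LTwo) - l • fourierLp (T := 2 * Real.pi) 2 (-1) := by
      rw [mulOp_eq_toeplitz_add hd hb f, hg, Submodule.coe_sub, Submodule.coe_smul]
      abel
    rw [h1]
    refine (norm_sub_le _ _).trans ?_
    rw [norm_smul, orthonormal_fourier.1, mul_one, Submodule.coe_norm]
  have hfv : ‖(f : LTwo)‖ ≤ δ⁻¹ * ‖w • (f : LTwo) - mulOp b f‖ := by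
    refine Lp.norm_le_mul_norm_of_ae_le_mul ?_
    filter_upwards [smul_sub_mulOp_ae hb w (f : LTwo)] with θ h1
    rw [h1, norm_neg, norm_mul, norm_mul, norm_fourier_apply, one_mul, inv_mul_eq_div,
      le_div_iff₀ hδ0, mul_comm]
    exact mul_le_mul_of_nonneg_right (hδ _ (norm_fourier_apply 1 θ)) (norm_nonneg _)
  calc ‖f‖ ≤ δ⁻¹ * (‖g‖ + 1 / (1 - ‖z‖) * ‖g‖) :=
        hfv.trans (mul_le_mul_of_nonneg_left (by linarith) (by positivity))
    _ = _ := by ring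

theorem norm_resolvent_le_of_forall {E : Type*} [NormedAddCommGroup E] [NormedSpace ℂ E]
    {S : E →L[ℂ] E} {w : ℂ} (hw : w ∈ resolventSet ℂ S) {K : ℝ} (hK : 0 ≤ K)
    (h : ∀ f, ‖f‖ ≤ K * ‖w • f - S f‖) : ‖resolvent S w‖ ≤ K := by
  refine ContinuousLinearMap.opNorm_le_bound _ hK fun g => ?_
  have h1 : (algebraMap ℂ (E →L[ℂ] E) w - S) * resolvent S w = 1 := Ring.mul_inverse_cancel _ hw
  have h2 := congrArg (fun A : E →L[ℂ] E => A g) h1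
  simp only [mul_apply_eq_comp, sub_apply,
    Algebra.algebraMap_eq_smul_one, smul_apply,
    one_apply_eq_self] at h2
  simpa only [h2] using h (resolvent S w g)

theorem quadraticResolventGrowth_toeplitz {b : LInfty} {d : ℕ → ℂ}
    (hd : Summable fun n => ‖d n‖) (hd' : Summable fun n : ℕ => (n : ℝ) * ‖d n‖)
    (hb : ∀ᵐ θ ∂circMeasure, b θ = fourier (-1) θ * diskSum d (fourier 1 θ)) :
    QuadraticResolventGrowth (toeplitz b) := by
  obtain ⟨L, hL0, hL⟩ := exists_le_mul_one_sub_norm hd hd'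
  refine ⟨L + 3, by linarith, fun w hw => ?_⟩
  have hwσ : w ∉ spectrum ℂ (toeplitz b) := fun h => h hw
  have hcirc : ∀ t : ℂ, ‖t‖ = 1 → diskSum d t / t ∈ spectrum ℂ (toeplitz b) := fun t ht =>
    mem_spectrum_of_diskSum_eq hd hd' hb ht
      (div_mul_cancel₀ _ (by rintro rfl; simp at ht)).symm
  set δ := Metric.infDist w (spectrum ℂ (toeplitz b)) with hδdef
  have hδ0 : 0 < δ := ((spectrum.isClosed (𝕜 := ℂ) (toeplitz b)).notMem_iff_infDist_pos
    ⟨_, hcirc 1 norm_one⟩).1 hwσ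
  have hδ : ∀ t : ℂ, ‖t‖ = 1 → δ ≤ ‖diskSum d t - w * t‖ := by
    intro t ht
    have ht0 : t ≠ 0 := by rintro rfl; simp at ht
    refine (Metric.infDist_le_dist_of_mem (hcirc t ht)).trans_eq ?_
    rw [dist_comm, dist_eq_norm, ← mul_one ‖_ / _ - w‖, ← ht, ← norm_mul, sub_mul,
      div_mul_cancel₀ _ ht0]
  obtain ⟨z, hz1, hwz⟩ : ∃ z : ℂ, ‖z‖ ≤ 1 ∧ diskSum d z = w * z := by
    by_contra! h
    exact hwσ (mem_spectrum_of_forall_ne hd hb h)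
  have hz : ‖z‖ < 1 := by
    refine lt_of_le_of_ne hz1 fun h1 => ?_
    have := hδ z h1
    rw [hwz, sub_self, norm_zero] at this
    linarith
  have hz' : 0 < 1 - ‖z‖ := by linarith
  -- The Lipschitz bound needs `z` away from `0`; for `‖z‖ ≤ 1 / 2` the left side is at most `2`.
  have hrad : 1 / (1 - ‖z‖) ≤ 2 + L / δ := by
    rcases le_total (1 / 2) ‖z‖ with h2 | h2
    · have h3 := hL w z δ hz h2 hwz hδ
      have : 1 / (1 - ‖z‖) ≤ L / δ := by
        rw [div_le_div_iff₀ hz' hδ0]; linarith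
      linarith
    · have : 1 / (1 - ‖z‖) ≤ 2 := by
        rw [div_le_iff₀ hz']; linarith
      have : 0 ≤ L / δ := by positivity
      linarith
  refine (norm_resolvent_le_of_forall hw (by positivity)
    (norm_le_of_diskSum_eq hd hb hz hwz hδ0 hδ)).trans ?_
  calc δ⁻¹ * (1 + 1 / (1 - ‖z‖)) ≤ δ⁻¹ * ((L + 3) * (1 + 1 / δ)) := by
        refine mul_le_mul_of_nonneg_left ?_ (by positivity)
        have : (L + 3) * (1 + 1 / δ) = 3 + L / δ + (L + 3 * (1 / δ)) := by ring
        have : 0 ≤ 1 / δ := by positivity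
        linarith
    _ = (L + 3) / δ * (1 + 1 / δ) := by ring

/-- `c j` are the coefficients `b_j` of the symbol `b(t) = ∑_{j ≥ -1} b_j t ^ j`. -/
theorem theorem3p1 (b : LInfty) (c : ℤ → ℂ)
    (hc : ∀ j : ℤ, j < -1 → c j = 0)
    (hsum : Summable fun j : ℕ => ((j : ℝ) + 1) * ‖c j‖)
    (hb : ∀ᵐ θ ∂circMeasure, HasSum (fun j : ℤ => c j * fourier j θ) (b θ)) :
    QuadraticResolventGrowth (toeplitz b) := by
  have hd' : Summable fun n : ℕ => (n : ℝ) * ‖c ((n : ℤ) - 1)‖ := by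
    rw [← summable_nat_add_iff 1]
    simpa using hsum
  have hd : Summable fun n : ℕ => ‖c ((n : ℤ) - 1)‖ := by
    rw [← summable_nat_add_iff 1]
    refine Summable.of_nonneg_of_le (fun _ => norm_nonneg _) (fun n => ?_) hsum
    have h1 : ((n + 1 : ℕ) : ℤ) - 1 = n := by push_cast; ring
    rw [h1]
    nlinarith [norm_nonneg (c n), (Nat.cast_nonneg n : (0 : ℝ) ≤ n)]
  have hb' : ∀ᵐ θ ∂circMeasure, b θ =
      fourier (-1) θ * diskSum (fun n : ℕ => c ((n : ℤ) - 1)) (fourier 1 θ) := by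
    filter_upwards [hb] with θ hθ
    have hinj : Function.Injective fun n : ℕ => (n : ℤ) - 1 := fun m n h => by
      simpa using h
    have hrange : ∀ j : ℤ, j ∉ Set.range (fun n : ℕ => (n : ℤ) - 1) → c j * fourier j θ = 0 := by
      intro j hj
      rw [hc j, zero_mul]
      by_contra! h
      exact hj ⟨(j + 1).toNat, by simp only; omega⟩
    have h1 : HasSum (fun n : ℕ => c ((n : ℤ) - 1) * fourier ((n : ℤ) - 1) θ) (b θ) :=
      (hinj.hasSum_iff hrange).2 hθ
    rw [← h1.tsum_eq, diskSum, ← tsum_mul_left]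
    refine tsum_congr fun n => ?_
    rw [sub_eq_neg_add, fourier_add, fourier_natCast]
    ring
  exact quadraticResolventGrowth_toeplitz hd hd' hb'
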